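/- Let $G$ be a connected semisimple Lie group with Lie algebra $\mathfrak g$, acting smoothly and isometrically on a (finite-dimensional, smooth) Lorentz manifold $M$. For $x\in M$ let $f_x:\mathfrak g\to T_xM$, $f_x(Y)=\frac{\partial}{\partial t}\big|_0 e^{tY}x$, and let $\langle\,,\rangle_x$ be the symmetric bilinear form on $\mathfrak g$ obtained by pulling back the Lorentz inner product of $T_xM$ by $f_x$. Call $X\in\mathfrak g$ $\mathbf R$-split if $\mathrm{ad}(X)$ is diagonalizable over $\mathbf R$. For a maximal abelian subalgebra $\mathfrak a\subset\mathfrak g$ of $\mathbf R$-split elements (maximal among the abelian subalgebras all of whose elements are $\mathbf R$-split) and $\alpha\in\mathfrak a^*$ put $\mathfrak g_\alpha=\{X\in\mathfrak g: [H,X]=\alpha(H)X \text{ for all } H\in\mathfrak a\}$; the root system of $\mathfrak g$ with respect to $\mathfrak a$ is $\Delta=\{\alpha\in\mathfrak a^*\setminus\{0\}:\mathfrak g_\alpha\neq 0\}$. Let $y\in M$ have stabilizer $G(y)$, and suppose there is a sequence $g_n\in G(y)$ with $\mathrm{Ad}(g_n)\to\infty$, i.e. leaving every compact set of linear endomorphisms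 of $\mathfrak g$. Then there are a maximal abelian subalgebra $\mathfrak a$ of $\mathbf R$-split elements, with root system $\Delta$, and a nonzero ($\mathbf R$-split) element $A\in\mathfrak a$ such that $$\bigoplus_{\alpha\in\Delta,\ \alpha(A)>0}\mathfrak g_\alpha$$ is an isotropic subspace for $\langle\,,\rangle_y$, i.e. $\langle U,V\rangle_y=0$ for all $U,V$ in it. Moreover, for these same $\mathfrak a$ and $A$: whenever $S^*$ is an isotropic vector field along the orbit $Gy$ (that is, $S^*(x)\in T_xM$ has zero Lorentz square for all $x\in Gy$) that is preserved by $G$ (that is, $g_*S^*(x)=S^*(gx)$ for all $g\in G$, $x\in Gy$), and $S\in\mathfrak g$ satisfies $f_y(S)=S^*(y)$, then, with respect to $\langle\,,\rangle_y$, $$\Big(\bigoplus_{\alpha\in\Delta,\ \alpha(A)>0}\mathfrak g_\alpha\Big)\perp S .$$ -/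

import Mathlib

open scoped Manifold ContDiff

noncomputable section

namespace KowalskyLorentz

/-! ### Split elements, restricted roots and restricted root spaces of a real Lie algebra -/

section RestrictedRoots

variable {L : Type*} [LieRing L] [LieAlgebra ℝ L]

/-- `X` is `ℝ`-split: `ad X` is diagonalizable over `ℝ`. -/
def IsRSplit (X : L) : Prop :=
  ⨆ c : ℝ, Module.End.eigenspace (LieAlgebra.ad ℝ L X : Module.End ℝ L) c = ⊤

/-- An abelian subspace consisting of `ℝ`-split elements. -/
def IsSplitAbelian (𝔞 : Submodule ℝ L) : Prop :=
  (∀ X ∈ 𝔞, ∀ Y ∈ 𝔞, ⁅X, Y⁆ = 0) ∧ ∀ X ∈ 𝔞, IsRSplit X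

/-- A maximal abelian `ℝ`-split subalgebra; for the Lie algebra of a semisimple Lie group these are
the Lie algebras of the maximal `ℝ`-split tori. -/
def IsMaximalSplitAbelian (𝔞 : Submodule ℝ L) : Prop :=
  Maximal IsSplitAbelian 𝔞

/-- `𝔤_α = {X | [H, X] = α(H) X for all H ∈ 𝔞}`. -/
def rootSpace (𝔞 : Submodule ℝ L) (α : Module.Dual ℝ 𝔞) : Submodule ℝ L :=
  ⨅ H : 𝔞, Module.End.eigenspace (LieAlgebra.ad ℝ L (H : L) : Module.End ℝ L) (α H)

/-- The root system `Δ` of `L` with respect to `𝔞`: the nonzero linear forms on `𝔞` with nonzero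
root space. -/
def rootSystem (𝔞 : Submodule ℝ L) : Set (Module.Dual ℝ 𝔞) :=
  {α | α ≠ 0 ∧ rootSpace 𝔞 α ≠ ⊥}

/-- The sum of the root spaces `𝔤_α` over the roots `α ∈ Δ` with `α(A) > 0`. -/
def positiveRootSum (𝔞 : Submodule ℝ L) (A : 𝔞) : Submodule ℝ L :=
  ⨆ α ∈ {α ∈ rootSystem 𝔞 | 0 < α A}, rootSpace 𝔞 α

theorem mem_rootSpace {𝔞 : Submodule ℝ L} {α : Module.Dual ℝ 𝔞} {X : L} :
    X ∈ rootSpace 𝔞 α ↔ ∀ H : 𝔞, ⁅(H : L), X⁆ = α H • X := by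
  simp [rootSpace, Submodule.mem_iInf]

/-- The root spaces are independent, so the sums of root spaces here are direct. -/
theorem iSupIndep_rootSpace {𝔞 : Submodule ℝ L} (h𝔞 : IsSplitAbelian 𝔞) :
    iSupIndep (rootSpace 𝔞) := by
  have hcomm : ∀ i j : 𝔞, Commute (LieAlgebra.ad ℝ L (i : L) : Module.End ℝ L)
      (LieAlgebra.ad ℝ L (j : L) : Module.End ℝ L) := by
    intro i j
    ext X
    have h := leibniz_lie (i : L) (j : L) X
    rw [h𝔞.1 i i.2 j j.2, zero_lie, zero_add] at h
    simpa using h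
  have h := Module.End.independent_iInf_maxGenEigenspace_of_forall_mapsTo
    (fun H : 𝔞 => (LieAlgebra.ad ℝ L (H : L) : Module.End ℝ L))
    (fun i j c => Module.End.mapsTo_maxGenEigenspace_of_comm (hcomm j i) c)
  have h' := h.comp (f := fun (α : Module.Dual ℝ 𝔞) (H : 𝔞) => α H) DFunLike.coe_injective
  exact h'.mono fun α => iInf_mono fun H => Module.End.eigenspace_le_maxGenEigenspace

end RestrictedRoots

/-! ### Lie groups -/

section LieGroups

variable {E : Type*} [NormedAddCommGroup E] [NormedSpace ℝ E]
  {G : Type*} [TopologicalSpace G] [ChartedSpace E G] [Group G]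

/-- A smooth Lie group is regular enough for Mathlib's Lie bracket on its Lie algebra. -/
instance instLieGroupMinSmoothness [LieGroup 𝓘(ℝ, E) ∞ G] :
    LieGroup 𝓘(ℝ, E) (minSmoothness ℝ 3) G :=
  LieGroup.of_le (n := ∞) (by rw [minSmoothness_of_isRCLikeNormedField]; exact ENat.LEInfty.out)

/-- The adjoint representation: `Ad g` is the derivative at `1` of `h ↦ g h g⁻¹`. -/
def Ad (g : G) : GroupLieAlgebra 𝓘(ℝ, E) G →L[ℝ] GroupLieAlgebra 𝓘(ℝ, E) G :=
  mfderiv 𝓘(ℝ, E) 𝓘(ℝ, E) (fun h : G => g * h * g⁻¹) 1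

end LieGroups

/-! ### Lorentz metrics and isometric actions -/

section Lorentz

variable (F : Type*) [NormedAddCommGroup F] [NormedSpace ℝ F]
  (M : Type*) [TopologicalSpace M] [ChartedSpace F M] [IsManifold 𝓘(ℝ, F) ∞ M]

/-- A smooth Lorentz metric: a smooth field of symmetric bilinear forms of signature
`(-, +, …, +)` on the tangent spaces. -/
structure LorentzMetric where
  /-- The bilinear form on the tangent space at `x`. -/
  form (x : M) : TangentSpace 𝓘(ℝ, F) x →L[ℝ] TangentSpace 𝓘(ℝ, F) x →L[ℝ] ℝ
  symm (x : M) (v w : TangentSpace 𝓘(ℝ, F) x) : form x v w = form x w v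
  /-- There is a timelike vector, and the form is positive definite on its orthogonal. -/
  signature (x : M) : ∃ t : TangentSpace 𝓘(ℝ, F) x, form x t t < 0 ∧
    ∀ v : TangentSpace 𝓘(ℝ, F) x, v ≠ 0 → form x t v = 0 → 0 < form x v v
  smooth : ContMDiff 𝓘(ℝ, F) (𝓘(ℝ, F).prod 𝓘(ℝ, F →L[ℝ] F →L[ℝ] ℝ)) ∞
    (fun x : M => Bundle.TotalSpace.mk' (F →L[ℝ] F →L[ℝ] ℝ)
      (E := fun x : M => TangentSpace 𝓘(ℝ, F) x →L[ℝ] TangentSpace 𝓘(ℝ, F) x →L[ℝ] ℝ) x (form x))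

variable {F M}

/-- `G` acts on `M` by isometries of the Lorentz metric `q`. -/
def IsIsometricAction (G : Type*) [Group G] [MulAction G M] (q : LorentzMetric F M) : Prop :=
  ∀ (g : G) (x : M) (v w : TangentSpace 𝓘(ℝ, F) x),
    q.form (g • x) (mfderiv 𝓘(ℝ, F) 𝓘(ℝ, F) (fun z : M => g • z) x v)
      (mfderiv 𝓘(ℝ, F) 𝓘(ℝ, F) (fun z : M => g • z) x w) = q.form x v w

variable {E : Type*} [NormedAddCommGroup E] [NormedSpace ℝ E]
  {G : Type*} [TopologicalSpace G] [ChartedSpace E G] [Group G] [MulAction G M]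

/-- `f_x : 𝔤 → T_x M`, `f_x(Y) = d/dt|₀ e^{tY} x`, i.e. the derivative at `1` of the orbit map
`g ↦ g x`. -/
def orbitDeriv (x : M) : GroupLieAlgebra 𝓘(ℝ, E) G →L[ℝ] TangentSpace 𝓘(ℝ, F) x :=
  mfderiv 𝓘(ℝ, E) 𝓘(ℝ, F) (fun g : G => g • x) 1

/-- `⟨Y, Z⟩_x`, the pullback by `f_x` to `𝔤` of the inner product on `T_x M`. -/
def pulledBackForm (q : LorentzMetric F M) (x : M) (Y Z : GroupLieAlgebra 𝓘(ℝ, E) G) : ℝ :=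
  q.form x (orbitDeriv x Y) (orbitDeriv x Z)

/-- `S` is an isotropic vector field along the orbit `G y`. Only the values of `S` on the orbit
matter. -/
def IsIsotropicAlongOrbit (G : Type*) [Group G] [MulAction G M] (q : LorentzMetric F M) (y : M)
    (S : (x : M) → TangentSpace 𝓘(ℝ, F) x) : Prop :=
  ∀ x ∈ MulAction.orbit G y, q.form x (S x) (S x) = 0

/-- The vector field `S` along the orbit `G y` is preserved by `G`. -/
def IsInvariantAlongOrbit (G : Type*) [Group G] [MulAction G M] (y : M)
    (S : (x : M) → TangentSpace 𝓘(ℝ, F) x) : Prop :=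
  ∀ (g : G), ∀ x ∈ MulAction.orbit G y,
    mfderiv 𝓘(ℝ, F) 𝓘(ℝ, F) (fun z : M => g • z) x (S x) = S (g • x)

end Lorentz

end KowalskyLorentz

end

/-!
The proof produces the split element `A` directly from the sequence `g n`, without a Cartan
decomposition of the group.

**Contraction.** Choose Euclidean coordinates on the Lie algebra `𝔤` and take singular value
decompositions `Ad (g n) ε_i = σ_i f_i`. Let `t → ∞` be the sum of the `|log σ_i|`. Along an
ultrafilter the frames `ε` and `f` converge, and `log σ_i / t` converges to exponents `lam i`, not
all zero. Vectors in the span of the limits `e i` with `lam i < 0` are limits of vectors `u n` with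
`Ad (g n) (u n) → 0`.

**Algebra.** Since `Ad (g n)` preserves the bracket and the Killing form, in the limit the
filtration of `𝔤` by the spans of the `e i` with `lam i ≤ c` is compatible with both
(`exists_isRSplit_asymptotically_contracted`). The Killing form is nondegenerate by Cartan's
criterion, and such a filtration comes from an element of `𝔤`: if `D` is the diagonal endomorphism
with entries `lam`, then the element `A` with `κ (A, Y) = tr (D ∘ ad Y)` satisfies
`ad A = D + strictly lowering` (`exists_ad_sub_smul_repr_eq_zero`). This repeats, modulo lower terms,
the proof that derivations of a semisimple Lie algebra are inner. Since equal weights carry scalar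
blocks, `ad A` is diagonalizable over `ℝ`, and its eigenvectors of eigenvalue `c` lie in the step `c`
of the filtration. So `-A` is split and nonzero, and its positive eigenvectors are asymptotically
contracted by `Ad (g n)`.

**Geometry.** As `g n` fixes `y`, the map `f_y` intertwines `Ad (g n)` with the isotropy action on
the tangent space at `y`, which preserves the metric. Hence contracted vectors are orthogonal to one
another and to every invariant vector (`form_orbitDeriv_eq_zero_of_tendsto`). A maximal split abelian
subalgebra containing the split element has its positive root spaces among the contracted vectors.
-/

namespace KowalskyLorentz

/-! ### Endomorphisms which are triangular for a weighted basis -/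

section WeightedBasis

variable {ι L : Type*} [Fintype ι] [AddCommGroup L] [Module ℝ L]

/-- With respect to a basis `e` whose vectors carry real weights `lam`, the endomorphism `T` raises
weights by at most `a`. -/
def RaisesLE (e : Module.Basis ι ℝ L) (lam : ι → ℝ) (a : ℝ) (T : Module.End ℝ L) : Prop :=
  ∀ j k, lam j + a < lam k → e.repr (T (e j)) k = 0

/-- With respect to a basis `e` whose vectors carry real weights `lam`, the endomorphism `T` raises
weights by strictly less than `a`. -/
def RaisesLT (e : Module.Basis ι ℝ L) (lam : ι → ℝ) (a : ℝ) (T : Module.End ℝ L) : Prop :=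
  ∀ j k, lam j + a ≤ lam k → e.repr (T (e j)) k = 0

theorem repr_apply_eq_sum (e : Module.Basis ι ℝ L) (T : Module.End ℝ L) (v : L) (k : ι) :
    e.repr (T v) k = ∑ j, e.repr v j * e.repr (T (e j)) k := by
  conv_lhs => rw [← e.sum_repr v]
  simp only [map_sum, map_smul, Finsupp.finsetSum_apply, Finsupp.smul_apply, smul_eq_mul]

variable {e : Module.Basis ι ℝ L} {lam : ι → ℝ} {a b : ℝ} {S T : Module.End ℝ L}

theorem RaisesLE.mul_raisesLT (hS : RaisesLE e lam a S) (hT : RaisesLT e lam b T) :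
    RaisesLT e lam (a + b) (S * T) := by
  intro j k h
  rw [Module.End.mul_apply, repr_apply_eq_sum]
  refine Finset.sum_eq_zero fun i _ => ?_
  rcases le_or_gt (lam j + b) (lam i) with hi | hi
  · rw [hT j i hi, zero_mul]
  · rw [hS i k (by linarith), mul_zero]

/-- A strictly lowering endomorphism has zero diagonal. -/
theorem RaisesLT.trace_eq_zero (hT : RaisesLT e lam a T) (ha : a ≤ 0) :
    LinearMap.trace ℝ L T = 0 := by
  classical
  rw [LinearMap.trace_eq_matrix_trace ℝ e, Matrix.trace]
  refine Finset.sum_eq_zero fun i _ => ?_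
  rw [Matrix.diag_apply, LinearMap.toMatrix_apply]
  exact hT i i (by linarith)

/-- `T - a` is surjective on a sum of eigenspaces of `T` for eigenvalues other than `a`. -/
theorem exists_apply_sub_smul_eq {T : Module.End ℝ L} {a : ℝ} {s : Finset ℝ} (ha : a ∉ s) {x : L}
    (hx : x ∈ ⨆ c ∈ s, Module.End.eigenspace T c) :
    ∃ u ∈ ⨆ c ∈ s, Module.End.eigenspace T c, T u - a • u = x := by
  have key : (⨆ c ∈ s, Module.End.eigenspace T c) ≤
      (⨆ c ∈ s, Module.End.eigenspace T c).map (T - a • (1 : Module.End ℝ L)) := by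
    refine iSup₂_le fun c hc v hv => ?_
    have hca : c - a ≠ 0 := sub_ne_zero.2 fun h => ha (h ▸ hc)
    refine ⟨(c - a)⁻¹ • v, Submodule.smul_mem _ _
      ((le_iSup₂ (f := fun c (_ : c ∈ s) => Module.End.eigenspace T c) c hc) hv), ?_⟩
    rw [Module.End.mem_eigenspace_iff] at hv
    rw [map_smul, LinearMap.sub_apply, hv, LinearMap.smul_apply, Module.End.one_apply, ← sub_smul,
      smul_smul, inv_mul_cancel₀ hca, one_smul]
  obtain ⟨u, hu, hux⟩ := key hx
  exact ⟨u, hu, by simpa using hux⟩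

/-- An endomorphism which is diagonal up to strictly lowering terms, with the weights themselves as
diagonal entries, is diagonalizable: since equal weights carry a scalar block, each eigenvector
equation can be solved one weight at a time. -/
theorem iSup_eigenspace_eq_top_of_raisesLT
    (hT : ∀ j k, lam j ≤ lam k → e.repr (T (e j) - lam j • e j) k = 0) :
    ⨆ c : ℝ, Module.End.eigenspace T c = ⊤ := by
  classical
  have key : ∀ s : Finset ℝ, (∀ k l, lam k ≤ lam l → lam l ∈ s → lam k ∈ s) →
      ∀ v, (∀ k, e.repr v k ≠ 0 → lam k ∈ s) → v ∈ ⨆ c ∈ s, Module.End.eigenspace T c := by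
    intro s
    induction s using Finset.induction_on_max with
    | empty =>
      intro _ v hv
      have : v = 0 := by
        apply e.repr.injective
        ext k
        by_contra h
        exact absurd (hv k (by simpa using h)) (by simp)
      rw [this]
      exact Submodule.zero_mem _
    | insert a s has ih =>
      intro hs v hv
      have ha : a ∉ s := fun h => lt_irrefl a (has a h)
      have hs' : ∀ k l, lam k ≤ lam l → lam l ∈ s → lam k ∈ s := by
        intro k l hkl hl
        have := hs k l hkl (Finset.mem_insert_of_mem hl)
        rcases Finset.mem_insert.1 this with h | h
        · exact absurd (has _ hl) (by rw [← h]; exact not_lt.2 hkl)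
        · exact h
      have hx : ∀ k, e.repr (T v - a • v) k ≠ 0 → lam k ∈ s := by
        intro k hk
        by_contra hks
        apply hk
        have h1 : e.repr (T v - a • v) k =
            ∑ j, e.repr v j * e.repr (T (e j) - a • e j) k := by
          simpa using repr_apply_eq_sum e (T - a • (1 : Module.End ℝ L)) v k
        rw [h1]
        refine Finset.sum_eq_zero fun j _ => ?_
        by_cases hj : e.repr v j = 0
        · rw [hj, zero_mul]
        have hjs := hv j hj
        have hjk : lam j ≤ lam k := by
          by_contra hlt
          have hkj := hs k j (not_le.1 hlt).le hjs
          rcases Finset.mem_insert.1 hkj with h | h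
          · rcases Finset.mem_insert.1 hjs with h' | h'
            · linarith
            · linarith [has _ h']
          · exact hks h
        have h2 := hT j k hjk
        rcases eq_or_ne j k with rfl | hne
        · have hja : lam j = a := (Finset.mem_insert.1 hjs).resolve_right hks
          rw [← hja, h2, mul_zero]
        · have : e.repr (T (e j) - a • e j) k = e.repr (T (e j) - lam j • e j) k := by
            simp [Finsupp.single_eq_of_ne hne.symm]
          rw [this, h2, mul_zero]
      obtain ⟨u, hu, hux⟩ := exists_apply_sub_smul_eq ha (ih hs' _ hx)
      rw [Finset.iSup_insert, ← sub_add_cancel v u]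
      refine Submodule.add_mem_sup ?_ hu
      rw [Module.End.mem_eigenspace_iff, map_sub, smul_sub]
      rw [sub_eq_sub_iff_add_eq_add] at hux
      rw [sub_eq_sub_iff_add_eq_add, ← hux]
      abel
  refine eq_top_iff.2 fun v _ => ?_
  have := key (Finset.univ.image lam) (fun k _ _ _ => by simp) v (fun k _ => by simp)
  exact (iSup₂_le fun c _ => le_iSup (fun c => Module.End.eigenspace T c) c) this

/-- An eigenvector of an endomorphism which is diagonal up to strictly lowering terms only involves
basis vectors whose weight is at most the eigenvalue. -/
theorem repr_eq_zero_of_mem_eigenspace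
    (hT : ∀ j k, lam j ≤ lam k → e.repr (T (e j) - lam j • e j) k = 0) {c : ℝ} {v : L}
    (hv : T v = c • v) {k : ι} (hk : c < lam k) : e.repr v k = 0 := by
  classical
  -- Otherwise the basis vector of highest weight occurring in `v` gives a contradiction.
  by_contra hne
  obtain ⟨m, hm, hmax⟩ := Finset.exists_max_image
    (Finset.univ.filter fun j => e.repr v j ≠ 0) lam ⟨k, by simpa using hne⟩
  rw [Finset.mem_filter] at hm
  have hkm : lam k ≤ lam m := hmax k (by simpa using hne)
  have h1 : e.repr (T v - lam m • v) m =
      ∑ j, e.repr v j * e.repr (T (e j) - lam m • e j) m := by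
    simpa using repr_apply_eq_sum e (T - lam m • (1 : Module.End ℝ L)) v m
  have h2 : e.repr (T v - lam m • v) m = 0 := by
    rw [h1]
    refine Finset.sum_eq_zero fun j _ => ?_
    by_cases hj : e.repr v j = 0
    · rw [hj, zero_mul]
    have h3 := hT j m (hmax j (by simpa using hj))
    rcases eq_or_ne j m with rfl | hjm
    · rw [h3, mul_zero]
    · have : e.repr (T (e j) - lam m • e j) m = e.repr (T (e j) - lam j • e j) m := by
        simp [Finsupp.single_eq_of_ne hjm.symm]
      rw [this, h3, mul_zero]
  rw [hv, ← sub_smul] at h2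
  simp only [map_smul, Finsupp.smul_apply, smul_eq_mul, mul_eq_zero] at h2
  rcases h2 with h | h
  · linarith
  · exact hm.2 h

end WeightedBasis

/-! ### Filtrations of a Lie algebra with nondegenerate Killing form -/

section Grading

variable {ι L : Type*} [Fintype ι] [LieRing L] [LieAlgebra ℝ L]

theorem ad_lie_eq_mul_sub_mul (x y : L) : LieAlgebra.ad ℝ L ⁅x, y⁆ =
    (LieAlgebra.ad ℝ L x * LieAlgebra.ad ℝ L y - LieAlgebra.ad ℝ L y * LieAlgebra.ad ℝ L x :
      Module.End ℝ L) := by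
  ext z
  simp

/-- If the structure constants respect the weights, `ad x` raises weights by at most `a` as soon as
`x` only involves basis vectors of weight at most `a`. -/
theorem raisesLE_ad {e : Module.Basis ι ℝ L} {lam : ι → ℝ}
    (hbr : ∀ i j k, lam i + lam j < lam k → e.repr ⁅e i, e j⁆ k = 0) {a : ℝ} {x : L}
    (hx : ∀ k, a < lam k → e.repr x k = 0) :
    RaisesLE e lam a (LieAlgebra.ad ℝ L x) := by
  intro j k h
  rw [LieAlgebra.ad_apply, ← lie_skew, map_neg, Finsupp.neg_apply, neg_eq_zero]
  have := repr_apply_eq_sum e (LieAlgebra.ad ℝ L (e j)) x k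
  rw [LieAlgebra.ad_apply] at this
  rw [this]
  refine Finset.sum_eq_zero fun i _ => ?_
  rcases le_or_gt (lam i) a with hi | hi
  · rw [LieAlgebra.ad_apply, hbr j i k (by linarith), mul_zero]
  · rw [hx i hi, zero_mul]

/-- A filtration of a Lie algebra with nondegenerate Killing form, compatible with the bracket and
with the Killing form, is the filtration by eigenvalues of `ad A` for some `A`. The filtration is
given by a weighted basis `e`, and `w` is the basis dual to `e` for the Killing form. The element
`A` represents, through the Killing form, the functional `Y ↦ tr (D ∘ ad Y)`, where `D` is the
diagonal endomorphism of the weights. -/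
theorem exists_ad_sub_smul_repr_eq_zero [Module.Finite ℝ L] [LieAlgebra.IsKilling ℝ L]
    (e : Module.Basis ι ℝ L) (lam : ι → ℝ)
    (hbr : ∀ i j k, lam i + lam j < lam k → e.repr ⁅e i, e j⁆ k = 0)
    (w : ι → L) (hw : ∀ k x, killingForm ℝ L (w k) x = e.repr x k)
    (hdual : ∀ i k, 0 < lam i + lam k → e.repr (w i) k = 0) :
    ∃ A : L, ∀ j k, lam j ≤ lam k → e.repr (⁅A, e j⁆ - lam j • e j) k = 0 := by
  classical
  set D : Module.End ℝ L := e.constr ℝ fun j => lam j • e j with hD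
  have hDe : ∀ j, D (e j) = lam j • e j := fun j => by rw [hD, e.constr_basis]
  obtain ⟨A, hA⟩ : ∃ A : L, ∀ Y, killingForm ℝ L A Y =
      LinearMap.trace ℝ L (D * LieAlgebra.ad ℝ L Y) := by
    let f : Module.Dual ℝ L := LinearMap.trace ℝ L ∘ₗ LinearMap.mulLeft ℝ D ∘ₗ
      (LieAlgebra.ad ℝ L : L →ₗ[ℝ] Module.End ℝ L)
    refine ⟨(LinearMap.BilinForm.toDual (killingForm ℝ L)
      (LieAlgebra.IsKilling.killingForm_nondegenerate ℝ L)).symm f, fun Y => ?_⟩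
    rw [LinearMap.BilinForm.apply_toDual_symm_apply]
    rfl
  refine ⟨A, fun j k hjk => ?_⟩
  set E : Module.End ℝ L := LieAlgebra.ad ℝ L A - D with hE
  have hEtr : ∀ Y, LinearMap.trace ℝ L (E * LieAlgebra.ad ℝ L Y) = 0 := by
    intro Y
    rw [hE, sub_mul, map_sub, ← hA, sub_eq_zero]
    rfl
  clear_value E
  -- `D` is a derivation up to terms of lower weight: `R` is its failure to be one on `e j`.
  set R : Module.End ℝ L := D * LieAlgebra.ad ℝ L (e j) - LieAlgebra.ad ℝ L (e j) * D -
    lam j • LieAlgebra.ad ℝ L (e j) with hR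
  have hRlt : RaisesLT e lam (lam j) R := by
    intro i l hil
    have h1 : e.repr (D ⁅e j, e i⁆) l = lam l * e.repr ⁅e j, e i⁆ l := by
      rw [repr_apply_eq_sum, Finset.sum_eq_single l]
      · rw [hDe]; simp; ring
      · intro m _ hm
        rw [hDe]; simp [Finsupp.single_eq_of_ne hm.symm]
      · simp
    have h2 : e.repr (R (e i)) l = (lam l - lam i - lam j) * e.repr ⁅e j, e i⁆ l := by
      rw [hR]
      simp only [LinearMap.sub_apply, Module.End.mul_apply, LieAlgebra.ad_apply, map_sub,
        Finsupp.sub_apply, h1, hDe, map_smul, Finsupp.smul_apply, smul_eq_mul,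
        LinearMap.smul_apply]
      ring
    rw [h2]
    rcases hil.eq_or_lt with h | h
    · rw [← h]; ring
    · rw [hbr j i l (by linarith), mul_zero]
  have hcomm : LieAlgebra.ad ℝ L (E (e j)) =
      E * LieAlgebra.ad ℝ L (e j) - LieAlgebra.ad ℝ L (e j) * E + R := by
    have h1 : E (e j) = ⁅A, e j⁆ - lam j • e j := by
      rw [hE, LinearMap.sub_apply, hDe, LieAlgebra.ad_apply]
    rw [h1, map_sub, ad_lie_eq_mul_sub_mul, map_smul, hR, hE]
    noncomm_ring
  clear_value R
  have h2 : e.repr (⁅A, e j⁆ - lam j • e j) k = killingForm ℝ L (w k) (E (e j)) := by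
    rw [hw, hE, LinearMap.sub_apply, hDe, LieAlgebra.ad_apply]
  rw [h2]
  -- Both halves of `tr (ad (w k) ∘ ad (E (e j)))` vanish: `ad (w k) * R` is strictly lowering, and
  -- the commutator with `E` is a trace against `E * ad Y`.
  change LinearMap.trace ℝ L (LieAlgebra.ad ℝ L (w k) * LieAlgebra.ad ℝ L (E (e j))) = 0
  rw [hcomm, mul_add, map_add]
  have h3 : LinearMap.trace ℝ L (LieAlgebra.ad ℝ L (w k) * R) = 0 :=
    ((raisesLE_ad hbr fun l hl => hdual k l (by linarith : 0 < lam k + lam l)).mul_raisesLT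
      hRlt).trace_eq_zero (a := -lam k + lam j) (by linarith)
  have h4 : LinearMap.trace ℝ L (LieAlgebra.ad ℝ L (w k) *
      (E * LieAlgebra.ad ℝ L (e j) - LieAlgebra.ad ℝ L (e j) * E)) =
      LinearMap.trace ℝ L (E * LieAlgebra.ad ℝ L ⁅e j, w k⁆) := by
    rw [ad_lie_eq_mul_sub_mul, mul_sub, mul_sub, map_sub, map_sub]
    congr 1
    · rw [LinearMap.trace_mul_comm, mul_assoc]
    · rw [← mul_assoc, LinearMap.trace_mul_comm]
  rw [h3, h4, hEtr, add_zero]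

/-- A filtration compatible with bracket and Killing form is cut out by a split element, which is
nonzero unless the filtration is trivial. -/
theorem exists_isRSplit_of_weightedBasis [Module.Finite ℝ L] [LieAlgebra.IsKilling ℝ L]
    (e : Module.Basis ι ℝ L) (lam : ι → ℝ)
    (hbr : ∀ i j k, lam i + lam j < lam k → e.repr ⁅e i, e j⁆ k = 0)
    (w : ι → L) (hw : ∀ k x, killingForm ℝ L (w k) x = e.repr x k)
    (hdual : ∀ i k, 0 < lam i + lam k → e.repr (w i) k = 0) (hlam : lam ≠ 0) :
    ∃ A : L, A ≠ 0 ∧ IsRSplit A ∧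
      ∀ (c : ℝ) (v : L), ⁅A, v⁆ = c • v → ∀ k, c < lam k → e.repr v k = 0 := by
  obtain ⟨A, hA⟩ := exists_ad_sub_smul_repr_eq_zero e lam hbr w hw hdual
  refine ⟨A, ?_, iSup_eigenspace_eq_top_of_raisesLT (T := LieAlgebra.ad ℝ L A) hA, ?_⟩
  · rintro rfl
    refine hlam (funext fun j => ?_)
    simpa using hA j j le_rfl
  · intro c v hv k hk
    exact repr_eq_zero_of_mem_eigenspace (T := LieAlgebra.ad ℝ L A) hA hv hk

end Grading


/-! ### Singular value decompositions and their limits -/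

section SingularValues

open Module

variable {V : Type*} [NormedAddCommGroup V] [InnerProductSpace ℝ V]

/-- Singular value decomposition of an automorphism of a Euclidean space. -/
theorem exists_orthonormalBasis_apply_eq_smul [FiniteDimensional ℝ V] {d : ℕ}
    (hd : finrank ℝ V = d) (ψ : V ≃ₗ[ℝ] V) :
    ∃ (ε f : OrthonormalBasis (Fin d) ℝ V) (σ : Fin d → ℝ),
      (∀ i, 0 < σ i) ∧ ∀ i, ψ (ε i) = σ i • f i := by
  set T : V →ₗ[ℝ] V := LinearMap.adjoint (ψ : V →ₗ[ℝ] V) ∘ₗ (ψ : V →ₗ[ℝ] V) with hT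
  have hTs : T.IsSymmetric := LinearMap.isSymmetric_adjoint_mul_self _
  set ε := hTs.eigenvectorBasis hd
  have hin : ∀ i j, inner ℝ (ψ (ε i)) (ψ (ε j)) = hTs.eigenvalues hd i * inner ℝ (ε i) (ε j) := by
    intro i j
    have h1 : inner ℝ (T (ε i)) (ε j) = inner ℝ (ψ (ε i)) (ψ (ε j)) := by
      rw [hT, LinearMap.comp_apply, LinearMap.adjoint_inner_left]
      rfl
    rw [← h1, hTs.apply_eigenvectorBasis, inner_smul_left]
    rfl
  have hpos : ∀ i, 0 < ‖ψ (ε i)‖ := by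
    intro i
    rw [norm_pos_iff]
    intro h
    exact ε.orthonormal.ne_zero i (by simpa using h)
  have hon : Orthonormal ℝ fun i => ‖ψ (ε i)‖⁻¹ • ψ (ε i) := by
    refine ⟨fun i => ?_, fun i j hij => ?_⟩
    · rw [norm_smul, norm_inv, norm_norm, inv_mul_cancel₀ (hpos i).ne']
    · change inner ℝ (‖ψ (ε i)‖⁻¹ • ψ (ε i)) (‖ψ (ε j)‖⁻¹ • ψ (ε j)) = 0
      rw [inner_smul_left, inner_smul_right, hin, ε.orthonormal.2 hij]
      simp
  have hcard : Fintype.card (Fin d) = finrank ℝ V := by rw [hd, Fintype.card_fin]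
  refine ⟨ε, OrthonormalBasis.mk hon ?_, fun i => ‖ψ (ε i)‖, hpos, fun i => ?_⟩
  · rw [hon.linearIndependent.span_eq_top_of_card_eq_finrank' hcard]
  · rw [OrthonormalBasis.coe_mk, smul_smul, mul_inv_cancel₀ (hpos i).ne', one_smul]

variable {ι : Type*} [Fintype ι] {ε f : OrthonormalBasis ι ℝ V} {σ : ι → ℝ} {ψ : V →ₗ[ℝ] V}

theorem inner_apply_of_apply_eq_smul (h : ∀ i, ψ (ε i) = σ i • f i) (v : V) (k : ι) :
    inner ℝ (f k) (ψ v) = σ k * inner ℝ (ε k) v := by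
  classical
  conv_lhs => rw [← ε.sum_repr' v]
  rw [map_sum, inner_sum, Finset.sum_eq_single k]
  · rw [map_smul, h, inner_smul_right, inner_smul_right, real_inner_self_eq_norm_sq,
      f.orthonormal.1 k]
    ring
  · intro j _ hj
    rw [map_smul, h, inner_smul_right, inner_smul_right, f.orthonormal.2 hj.symm]
    simp
  · simp

theorem norm_toContinuousLinearMap_le_sum [FiniteDimensional ℝ V] (hσ : ∀ i, 0 < σ i) (h : ∀ i, ψ (ε i) = σ i • f i) :
    ‖LinearMap.toContinuousLinearMap ψ‖ ≤ ∑ i, σ i := by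
  refine ContinuousLinearMap.opNorm_le_bound _ (Finset.sum_nonneg fun i _ => (hσ i).le) fun v => ?_
  rw [LinearMap.coe_toContinuousLinearMap']
  conv_lhs => rw [← ε.sum_repr' v]
  rw [map_sum, Finset.sum_mul]
  refine norm_sum_le_of_le _ fun i _ => ?_
  rw [map_smul, h, norm_smul, norm_smul, f.orthonormal.1 i, mul_one, Real.norm_of_nonneg (hσ i).le,
    mul_comm]
  refine mul_le_mul_of_nonneg_left ?_ (hσ i).le
  calc ‖inner ℝ (ε i) v‖ ≤ ‖ε i‖ * ‖v‖ := norm_inner_le_norm _ _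
    _ = ‖v‖ := by rw [ε.orthonormal.1 i, one_mul]

end SingularValues

section Limits

open Filter Topology Module

theorem tendsto_exp_mul_zero {X : Type*} {l : Filter X} {t u : X → ℝ} {a : ℝ}
    (ht : Tendsto t l atTop) (hu : Tendsto u l (𝓝 a)) (ha : a < 0) :
    Tendsto (fun x => Real.exp (t x * u x)) l (𝓝 0) :=
  Real.tendsto_exp_atBot.comp (ht.atTop_mul_neg ha hu)

theorem orthonormal_of_tendsto {V : Type*} [NormedAddCommGroup V] [InnerProductSpace ℝ V]
    {X ι : Type*} {l : Filter X} [l.NeBot] {ε : X → ι → V} {e : ι → V}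
    (hε : ∀ x, Orthonormal ℝ (ε x)) (h : ∀ i, Tendsto (fun x => ε x i) l (𝓝 (e i))) :
    Orthonormal ℝ e := by
  refine ⟨fun i => ?_, fun i j hij => ?_⟩
  · refine tendsto_nhds_unique (h i).norm ?_
    simp only [(hε _).1 i]
    exact tendsto_const_nhds
  · refine tendsto_nhds_unique ((h i).inner (𝕜 := ℝ) (h j)) ?_
    simp only [(hε _).2 hij]
    exact tendsto_const_nhds

theorem exists_tendsto_ultrafilter_of_norm_le {X V : Type*} [NormedAddCommGroup V] [ProperSpace V]
    (U : Ultrafilter X) (u : X → V) {C : ℝ} (hu : ∀ x, ‖u x‖ ≤ C) :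
    ∃ v, Tendsto u U (𝓝 v) := by
  obtain ⟨v, -, hv⟩ := (isCompact_closedBall (0 : V) C).ultrafilter_le_nhds (U.map u) (by
    rw [le_principal_iff]
    exact (Filter.Eventually.of_forall fun x => mem_closedBall_zero_iff.2 (hu x) :
      ∀ᶠ x in U, u x ∈ Metric.closedBall 0 C))
  exact ⟨v, hv⟩

/-- Singular value decompositions of a sequence of automorphisms tending to infinity, in the limit
along an ultrafilter: the singular frames converge, and the singular values are `exp (t * r)` with
`t → ∞` and `r` converging to a nonzero vector of exponents `lam`. -/
theorem exists_limit_singular_frames {V : Type*} [NormedAddCommGroup V] [InnerProductSpace ℝ V]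
    [FiniteDimensional ℝ V] {d : ℕ} (hd : finrank ℝ V = d) (ψ : ℕ → V ≃ₗ[ℝ] V)
    (hψ : Tendsto (fun n => ‖LinearMap.toContinuousLinearMap (ψ n : V →ₗ[ℝ] V)‖) atTop atTop) :
    ∃ (l : Filter ℕ) (ε f : ℕ → OrthonormalBasis (Fin d) ℝ V) (t : ℕ → ℝ) (r : ℕ → Fin d → ℝ)
      (e f' : OrthonormalBasis (Fin d) ℝ V) (lam : Fin d → ℝ),
      l.NeBot ∧ (∀ n i, ψ n (ε n i) = Real.exp (t n * r n i) • f n i) ∧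
      Tendsto t l atTop ∧ (∀ i, Tendsto (fun n => ε n i) l (𝓝 (e i))) ∧
      (∀ i, Tendsto (fun n => f n i) l (𝓝 (f' i))) ∧
      (∀ i, Tendsto (fun n => r n i) l (𝓝 (lam i))) ∧ lam ≠ 0 := by
  choose ε f σ hσ hεf using fun n => exists_orthonormalBasis_apply_eq_smul hd (ψ n)
  -- With this normalization, the exponents `log σ / t` have absolute values summing to `1`, so that
  -- their limit cannot vanish.
  set t : ℕ → ℝ := fun n => ∑ i, |Real.log (σ n i)| with ht_def
  set r : ℕ → Fin d → ℝ := fun n i => Real.log (σ n i) / t n with hr_def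
  have hlog_le : ∀ n i, |Real.log (σ n i)| ≤ t n := fun n i =>
    Finset.single_le_sum (f := fun i => |Real.log (σ n i)|) (fun i _ => abs_nonneg _)
      (Finset.mem_univ i)
  have ht0 : ∀ n, 0 ≤ t n := fun n => Finset.sum_nonneg fun i _ => abs_nonneg _
  -- If `t n = 0`, then all singular values are `1`, and the junk value `r n i = 0` is harmless.
  have hσ_eq : ∀ n i, σ n i = Real.exp (t n * r n i) := by
    intro n i
    rcases (ht0 n).eq_or_lt with h | h
    · have h1 : Real.log (σ n i) = 0 :=
        abs_eq_zero.1 (le_antisymm ((hlog_le n i).trans h.ge) (abs_nonneg _))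
      rw [← h, zero_mul, ← h1, Real.exp_log (hσ n i)]
    · rw [hr_def, mul_div_cancel₀ _ h.ne', Real.exp_log (hσ n i)]
  have ht : Tendsto t atTop atTop := by
    refine tendsto_atTop.2 fun b => ?_
    filter_upwards [hψ.eventually_gt_atTop (d * Real.exp b)] with n hn
    by_contra! hb
    have h1 : ∑ i, σ n i ≤ d * Real.exp b := by
      calc ∑ i, σ n i ≤ ∑ _i : Fin d, Real.exp b := by
            refine Finset.sum_le_sum fun i _ => ?_
            rw [← Real.exp_log (hσ n i)]
            exact Real.exp_le_exp.2 ((le_abs_self _).trans ((hlog_le n i).trans hb.le))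
        _ = d * Real.exp b := by simp
    exact absurd (hn.trans_le ((norm_toContinuousLinearMap_le_sum (hσ n) (hεf n)).trans h1))
      (lt_irrefl _)
  have hr1 : ∀ n i, |r n i| ≤ 1 := fun n i => by
    rw [hr_def, abs_div, abs_of_nonneg (ht0 n)]
    exact div_le_one_of_le₀ (hlog_le n i) (ht0 n)
  have : ProperSpace V := FiniteDimensional.proper ℝ V
  set U : Ultrafilter ℕ := hyperfilter ℕ
  have hU : (U : Filter ℕ) ≤ atTop := Nat.hyperfilter_le_atTop
  have hlim_V : ∀ g : ℕ → OrthonormalBasis (Fin d) ℝ V, ∃ g' : OrthonormalBasis (Fin d) ℝ V,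
      ∀ i, Tendsto (fun n => g n i) U (𝓝 (g' i)) := by
    intro g
    choose g' hg' using fun i => exists_tendsto_ultrafilter_of_norm_le U (fun n => g n i)
      (fun n => ((g n).orthonormal.1 i).le)
    have hon := orthonormal_of_tendsto (fun n => (g n).orthonormal) hg'
    have hcard : Fintype.card (Fin d) = finrank ℝ V := by rw [hd, Fintype.card_fin]
    refine ⟨OrthonormalBasis.mk hon ?_, fun i => ?_⟩
    · rw [hon.linearIndependent.span_eq_top_of_card_eq_finrank' hcard]
    · rw [OrthonormalBasis.coe_mk]
      exact hg' i
  obtain ⟨e, he⟩ := hlim_V ε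
  obtain ⟨f', hf'⟩ := hlim_V f
  choose lam hlam using fun i => exists_tendsto_ultrafilter_of_norm_le U (fun n => r n i)
    (fun n => hr1 n i)
  refine ⟨U, ε, f, t, r, e, f', lam, inferInstance, fun n i => ?_, ht.mono_left hU, he, hf',
    hlam, ?_⟩
  · rw [← hσ_eq, hεf]
  · rintro rfl
    have h1 : Tendsto (fun n => ∑ i, |r n i|) U (𝓝 (∑ _i : Fin d, |(0 : ℝ)|)) :=
      tendsto_finsetSum _ fun i _ => (hlam i).abs
    have h2 : Tendsto (fun n => ∑ i, |r n i|) U (𝓝 1) := by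
      refine tendsto_const_nhds.congr' ?_
      filter_upwards [hU (ht.eventually_gt_atTop 0)] with n hn
      rw [hr_def]
      simp only [abs_div, abs_of_pos hn]
      rw [← Finset.sum_div, div_self hn.ne']
    have := tendsto_nhds_unique h1 h2
    simp at this

end Limits


/-! ### Asymptotic contraction by a sequence of automorphisms -/

section Contraction

open Filter Topology Module

variable {L : Type*} [LieRing L] [LieAlgebra ℝ L]

theorem tendsto_linearMap₂ {V W : Type*} [NormedAddCommGroup V] [NormedSpace ℝ V]
    [FiniteDimensional ℝ V] [NormedAddCommGroup W] [NormedSpace ℝ W] {X : Type*} {l : Filter X}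
    (β : V →ₗ[ℝ] V →ₗ[ℝ] W) {u v : X → V} {a b : V} (hu : Tendsto u l (𝓝 a))
    (hv : Tendsto v l (𝓝 b)) : Tendsto (fun x => β (u x) (v x)) l (𝓝 (β a b)) :=
  (β.toContinuousBilinearMap.continuous₂.tendsto (a, b)).comp (hu.prodMk_nhds hv)

theorem IsRSplit.smul {X : L} (hX : IsRSplit X) (s : ℝ) : IsRSplit (s • X) := by
  refine eq_top_iff.2 (hX.ge.trans (iSup_le fun c => ?_))
  refine le_trans (fun v hv => ?_) (le_iSup _ (s * c))
  rw [End.mem_eigenspace_iff, LieAlgebra.ad_apply] at hv ⊢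
  rw [smul_lie, hv, smul_smul]

/-- Automorphisms `φ n` of a Lie algebra with nondegenerate Killing form which tend to infinity are,
along some filter, asymptotically contracting on the positive eigenspaces of a nonzero split
element `A`. Here `Φ` is an arbitrary Euclidean coordinate system on the Lie algebra. -/
theorem exists_isRSplit_asymptotically_contracted [LieAlgebra.IsKilling ℝ L]
    {d : ℕ} (Φ : L ≃ₗ[ℝ] EuclideanSpace ℝ (Fin d)) (φ : ℕ → L ≃ₗ⁅ℝ⁆ L)
    (hφ : Tendsto (fun n => ‖LinearMap.toContinuousLinearMap
      ((Φ.symm ≪≫ₗ (φ n).toLinearEquiv ≪≫ₗ Φ :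
        EuclideanSpace ℝ (Fin d) ≃ₗ[ℝ] EuclideanSpace ℝ (Fin d)) :
        EuclideanSpace ℝ (Fin d) →ₗ[ℝ] EuclideanSpace ℝ (Fin d))‖) atTop atTop) :
    ∃ (A : L) (l : Filter ℕ), A ≠ 0 ∧ IsRSplit A ∧ l.NeBot ∧
      ∀ (c : ℝ) (U : L), 0 < c → ⁅A, U⁆ = c • U → ∃ u : ℕ → L,
        Tendsto (fun n => Φ (u n)) l (𝓝 (Φ U)) ∧ Tendsto (fun n => Φ (φ n (u n))) l (𝓝 0) := by
  have : Module.Finite ℝ L := Module.Finite.equiv Φ.symm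
  obtain ⟨l, ε, f, t, r, e, f', lam, hl, hψ, ht, hε, hf, hr, hlam⟩ :=
    exists_limit_singular_frames finrank_euclideanSpace_fin _ hφ
  have hψ' : ∀ n i, Φ (φ n (Φ.symm (ε n i))) = Real.exp (t n * r n i) • f n i := hψ
  have hcoord : ∀ n x k, inner ℝ (f n k) (Φ (φ n x)) =
      Real.exp (t n * r n k) * inner ℝ (ε n k) (Φ x) := by
    intro n x k
    have := inner_apply_of_apply_eq_smul (hψ n) (Φ x) k
    simpa using this
  have hexp : ∀ n i, Real.exp (t n * r n i) ≠ 0 := fun n i => (Real.exp_pos _).ne'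
  set b : Basis (Fin d) ℝ L := e.toBasis.map Φ.symm with hb
  have hbe : ∀ i, b i = Φ.symm (e i) := fun i => by simp [hb]
  have hbr : ∀ x k, b.repr x k = inner ℝ (e k) (Φ x) := fun x k => by
    simp [hb, OrthonormalBasis.repr_apply_apply]
  -- The bracket, and the inverse `R` of the Killing form, in Euclidean coordinates.
  obtain ⟨β, hβ⟩ : ∃ β : EuclideanSpace ℝ (Fin d) →ₗ[ℝ] EuclideanSpace ℝ (Fin d) →ₗ[ℝ]
      EuclideanSpace ℝ (Fin d), ∀ v w, β v w = Φ ⁅Φ.symm v, Φ.symm w⁆ :=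
    ⟨LinearMap.mk₂ ℝ (fun v w => Φ ⁅Φ.symm v, Φ.symm w⁆) (by simp) (by simp) (by simp) (by simp),
      fun v w => rfl⟩
  have hκ := LieAlgebra.IsKilling.killingForm_nondegenerate ℝ L
  obtain ⟨R, hR⟩ : ∃ R : EuclideanSpace ℝ (Fin d) →ₗ[ℝ] L,
      ∀ v x, killingForm ℝ L (R v) x = inner ℝ v (Φ x) :=
    ⟨((LinearMap.BilinForm.toDual (killingForm ℝ L) hκ).symm : Module.Dual ℝ L →ₗ[ℝ] L) ∘ₗ
      LinearMap.lcomp ℝ ℝ (Φ : L →ₗ[ℝ] EuclideanSpace ℝ (Fin d)) ∘ₗ innerₗ _,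
      fun v x => LinearMap.BilinForm.apply_toDual_symm_apply (hB := hκ) _ _⟩
  have hRc : Continuous fun v => Φ (R v) :=
    ((Φ : L →ₗ[ℝ] EuclideanSpace ℝ (Fin d)) ∘ₗ R).continuous_of_finiteDimensional
  -- The bracket respects the exponents: since `φ n` preserves it, its structure constants in the
  -- frames `ε n` and `f n` differ by a ratio of singular values, which tends to zero.
  have h1 : ∀ i j k, lam i + lam j < lam k → b.repr ⁅b i, b j⁆ k = 0 := by
    intro i j k hijk
    have hid : ∀ n, inner ℝ (ε n k) (β (ε n i) (ε n j)) =
        Real.exp (t n * (r n i + r n j - r n k)) * inner ℝ (f n k) (β (f n i) (f n j)) := by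
      intro n
      have h := hcoord n ⁅Φ.symm (ε n i), Φ.symm (ε n j)⁆ k
      have hfi : ∀ i, φ n (Φ.symm (ε n i)) = Real.exp (t n * r n i) • Φ.symm (f n i) := fun i => by
        rw [← map_smul, ← hψ', LinearEquiv.symm_apply_apply]
      rw [LieEquiv.map_lie, hfi, hfi, smul_lie, lie_smul, map_smul, map_smul, ← hβ, ← hβ,
        inner_smul_right, inner_smul_right] at h
      rw [mul_sub, mul_add, Real.exp_sub, Real.exp_add, div_mul_eq_mul_div, eq_div_iff (hexp n k),
        mul_comm, ← h]
      ring
    have hlhs : Tendsto (fun n => inner ℝ (ε n k) (β (ε n i) (ε n j))) l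
        (𝓝 (inner ℝ (e k) (β (e i) (e j)))) :=
      (hε k).inner (tendsto_linearMap₂ β (hε i) (hε j))
    have hrhs := (tendsto_exp_mul_zero ht (((hr i).add (hr j)).sub (hr k)) (by linarith)).mul
      ((hf k).inner (𝕜 := ℝ) (tendsto_linearMap₂ β (hf i) (hf j)))
    rw [hbr, hbe, hbe, ← hβ]
    rw [zero_mul] at hrhs
    exact tendsto_nhds_unique hlhs (hrhs.congr fun n => (hid n).symm)
  -- So does the inverse of the Killing form, which `φ n` preserves as well.
  have h2 : ∀ i k, 0 < lam i + lam k → b.repr (R (e i)) k = 0 := by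
    intro i k hik
    have hRf : ∀ n, φ n (R (ε n i)) = Real.exp (-(t n * r n i)) • R (f n i) := by
      intro n
      refine LinearMap.ker_eq_bot.1 (LieAlgebra.IsKilling.ker_killingForm_eq_bot ℝ L) ?_
      ext x
      obtain ⟨z, rfl⟩ : ∃ z, φ n z = x := (φ n).surjective x
      have h := hcoord n z i
      rw [LieAlgebra.killingForm_of_equiv_apply, map_smul, LinearMap.smul_apply, hR, hR, h,
        smul_eq_mul, ← mul_assoc, ← Real.exp_add, neg_add_cancel, Real.exp_zero, one_mul]
    have hid : ∀ n, inner ℝ (ε n k) (Φ (R (ε n i))) =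
        Real.exp (t n * -(r n i + r n k)) * inner ℝ (f n k) (Φ (R (f n i))) := by
      intro n
      have h := hcoord n (R (ε n i)) k
      rw [hRf, map_smul, inner_smul_right] at h
      rw [← mul_right_inj' (hexp n k), ← h, ← mul_assoc, ← Real.exp_add]
      congr 2
      ring
    have hlhs : Tendsto (fun n => inner ℝ (ε n k) (Φ (R (ε n i)))) l
        (𝓝 (inner ℝ (e k) (Φ (R (e i))))) :=
      (hε k).inner ((hRc.tendsto (e i)).comp (hε i))
    have hrhs := (tendsto_exp_mul_zero ht ((hr i).add (hr k)).neg (by linarith)).mul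
      ((hf k).inner (𝕜 := ℝ) ((hRc.tendsto (f' i)).comp (hf i)))
    rw [hbr]
    rw [zero_mul] at hrhs
    exact tendsto_nhds_unique hlhs (hrhs.congr fun n => (hid n).symm)
  obtain ⟨A, hA0, hAs, hA⟩ := exists_isRSplit_of_weightedBasis b lam h1 (fun i => R (e i))
    (fun k x => by rw [hR, hbr]) h2 hlam
  -- `φ n` contracts the directions of negative exponent, hence the sign.
  refine ⟨-A, l, neg_ne_zero.2 hA0, ?_, hl, fun c U hc hU => ?_⟩
  · simpa using hAs.smul (-1)
  have hU' : ∀ k, -c < lam k → inner ℝ (e k) (Φ U) = 0 := by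
    intro k hk
    rw [← hbr]
    refine hA (-c) U ?_ k hk
    rw [neg_smul, ← hU, neg_lie, neg_neg]
  -- Approximate `U` by the vectors with the same coordinates in the frames `ε n`.
  refine ⟨fun n => ∑ k, inner ℝ (e k) (Φ U) • Φ.symm (ε n k), ?_, ?_⟩
  · simp only [map_sum, map_smul, LinearEquiv.apply_symm_apply]
    have := tendsto_finsetSum Finset.univ fun k _ => (hε k).const_smul (inner ℝ (e k) (Φ U))
    rwa [e.sum_repr'] at this
  · simp only [map_sum, map_smul, hψ']
    have hk : ∀ k, Tendsto (fun n => inner ℝ (e k) (Φ U) • Real.exp (t n * r n k) • f n k) l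
        (𝓝 0) := by
      intro k
      rcases lt_or_ge (-c) (lam k) with hk | hk
      · simp only [hU' k hk, zero_smul]
        exact tendsto_const_nhds
      · have := ((tendsto_exp_mul_zero ht (hr k) (by linarith)).smul (hf k)).const_smul
          (inner ℝ (e k) (Φ U))
        rwa [zero_smul, smul_zero] at this
    have := tendsto_finsetSum Finset.univ fun k _ => hk k
    rwa [Finset.sum_const_zero] at this

end Contraction


/-! ### The adjoint representation of a Lie group -/

section Adjoint

variable {E : Type*} [NormedAddCommGroup E] [NormedSpace ℝ E]
  {G : Type*} [TopologicalSpace G] [ChartedSpace E G] [Group G]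

theorem mulInvariantVectorField_one (X : GroupLieAlgebra 𝓘(ℝ, E) G) :
    mulInvariantVectorField X (1 : G) = X := by
  have h : (mfderiv 𝓘(ℝ, E) 𝓘(ℝ, E) (fun x : G => 1 * x) 1 : E →L[ℝ] E) X = X := by
    have : (fun x : G => 1 * x) = id := by
      ext x
      simp
    rw [this, mfderiv_id]
    rfl
  exact h

variable [LieGroup 𝓘(ℝ, E) ∞ G]

theorem contMDiff_conj (g : G) : ContMDiff 𝓘(ℝ, E) 𝓘(ℝ, E) ∞ fun h : G => g * h * g⁻¹ :=
  (contMDiff_mul_right (a := g⁻¹)).comp (contMDiff_mul_left (a := g))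

theorem mdifferentiable_conj (g : G) : MDifferentiable 𝓘(ℝ, E) 𝓘(ℝ, E) fun h : G => g * h * g⁻¹ :=
  (contMDiff_conj g).mdifferentiable (by simp)

/-- The chain rule, with tangent spaces identified with the model spaces, so that the base point of
the outer derivative can be given up to propositional equality. -/
theorem mfderiv_comp_apply_of_eq {E₁ E₂ E₃ M₁ M₂ M₃ : Type*}
    [NormedAddCommGroup E₁] [NormedSpace ℝ E₁] [NormedAddCommGroup E₂] [NormedSpace ℝ E₂]
    [NormedAddCommGroup E₃] [NormedSpace ℝ E₃]
    [TopologicalSpace M₁] [ChartedSpace E₁ M₁] [TopologicalSpace M₂] [ChartedSpace E₂ M₂]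
    [TopologicalSpace M₃] [ChartedSpace E₃ M₃] {f : M₁ → M₂} {k : M₂ → M₃} {x : M₁} {z : M₂}
    (hz : f x = z) (hk : MDifferentiableAt 𝓘(ℝ, E₂) 𝓘(ℝ, E₃) k z)
    (hf : MDifferentiableAt 𝓘(ℝ, E₁) 𝓘(ℝ, E₂) f x) (v : E₁) :
    (mfderiv 𝓘(ℝ, E₁) 𝓘(ℝ, E₃) (fun x => k (f x)) x : E₁ →L[ℝ] E₃) v =
      (mfderiv 𝓘(ℝ, E₂) 𝓘(ℝ, E₃) k z : E₂ →L[ℝ] E₃)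
        ((mfderiv 𝓘(ℝ, E₁) 𝓘(ℝ, E₂) f x : E₁ →L[ℝ] E₂) v) := by
  subst hz
  exact congrArg (fun T : E₁ →L[ℝ] E₃ => T v) (mfderiv_comp x hk hf)

theorem mfderiv_conj_inv_apply (g h : G) (v : E) :
    (mfderiv 𝓘(ℝ, E) 𝓘(ℝ, E) (fun h : G => g⁻¹ * h * g⁻¹⁻¹) (g * h * g⁻¹) : E →L[ℝ] E)
      ((mfderiv 𝓘(ℝ, E) 𝓘(ℝ, E) (fun h : G => g * h * g⁻¹) h : E →L[ℝ] E) v) = v := by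
  have h1 := mfderiv_comp_apply_of_eq (f := fun h : G => g * h * g⁻¹)
    (k := fun h : G => g⁻¹ * h * g⁻¹⁻¹) (x := h) rfl (mdifferentiable_conj g⁻¹).mdifferentiableAt
    (mdifferentiable_conj g).mdifferentiableAt v
  rw [← h1]
  have : (fun x : G => g⁻¹ * (g * x * g⁻¹) * g⁻¹⁻¹) = id := by
    ext x
    simp [mul_assoc]
  rw [this, mfderiv_id]
  rfl

theorem Ad_inv_apply_Ad_apply (g : G) (X : GroupLieAlgebra 𝓘(ℝ, E) G) :
    Ad (E := E) g⁻¹ (Ad g X) = X := by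
  have := mfderiv_conj_inv_apply (E := E) g 1 X
  rw [mul_one, mul_inv_cancel] at this
  exact this

theorem Ad_apply_Ad_inv_apply (g : G) (X : GroupLieAlgebra 𝓘(ℝ, E) G) :
    Ad (E := E) g (Ad g⁻¹ X) = X := by
  simpa using Ad_inv_apply_Ad_apply g⁻¹ X

/-- Conjugation by `g` carries the left-invariant vector field of `X` to that of `Ad g X`. -/
theorem mfderiv_conj_mulInvariantVectorField (g h : G) (X : GroupLieAlgebra 𝓘(ℝ, E) G) :
    (mfderiv 𝓘(ℝ, E) 𝓘(ℝ, E) (fun h : G => g * h * g⁻¹) h : E →L[ℝ] E)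
      (mulInvariantVectorField X h) = mulInvariantVectorField (Ad g X) (g * h * g⁻¹) := by
  have hl : ∀ a : G, MDifferentiable 𝓘(ℝ, E) 𝓘(ℝ, E) fun x : G => a * x := fun a =>
    (contMDiff_mul_left (n := ∞)).mdifferentiable (by simp)
  have h1 := mfderiv_comp_apply_of_eq (f := fun x : G => h * x) (k := fun h : G => g * h * g⁻¹)
    (x := 1) (mul_one h) (mdifferentiable_conj g).mdifferentiableAt (hl h).mdifferentiableAt X
  have h2 := mfderiv_comp_apply_of_eq (f := fun h : G => g * h * g⁻¹)
    (k := fun x : G => g * h * g⁻¹ * x) (x := 1) (z := 1) (by simp)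
    (hl _).mdifferentiableAt (mdifferentiable_conj g).mdifferentiableAt X
  have h3 : (fun x : G => g * (h * x) * g⁻¹) = fun x => g * h * g⁻¹ * (g * x * g⁻¹) := by
    ext x
    simp [mul_assoc]
  rw [h3] at h1
  exact h1.symm.trans h2

theorem mpullback_conj_mulInvariantVectorField (g : G) (X : GroupLieAlgebra 𝓘(ℝ, E) G) :
    VectorField.mpullback 𝓘(ℝ, E) 𝓘(ℝ, E) (fun h : G => g * h * g⁻¹)
      (mulInvariantVectorField (Ad g X)) = mulInvariantVectorField X := by
  ext h
  rw [VectorField.mpullback_apply]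
  let T : E →L[ℝ] E := mfderiv 𝓘(ℝ, E) 𝓘(ℝ, E) (fun h : G => g * h * g⁻¹) h
  let T' : E →L[ℝ] E :=
    mfderiv 𝓘(ℝ, E) 𝓘(ℝ, E) (fun h : G => g⁻¹ * h * g⁻¹⁻¹) (g * h * g⁻¹)
  have hT'T : ∀ v, T' (T v) = v := mfderiv_conj_inv_apply g h
  have hTT' : ∀ v, T (T' v) = v := by
    intro v
    have h1 := mfderiv_comp_apply_of_eq (f := fun h : G => g⁻¹ * h * g⁻¹⁻¹)
      (k := fun h : G => g * h * g⁻¹) (x := g * h * g⁻¹) (z := h) (by simp [mul_assoc])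
      (mdifferentiable_conj g).mdifferentiableAt (mdifferentiable_conj g⁻¹).mdifferentiableAt v
    refine h1.symm.trans ?_
    have : (fun x : G => g * (g⁻¹ * x * g⁻¹⁻¹) * g⁻¹) = id := by
      ext x
      simp [mul_assoc]
    rw [this, mfderiv_id]
    rfl
  have hinv : T.inverse = T' := ContinuousLinearMap.inverse_eq
    (ContinuousLinearMap.ext hTT') (ContinuousLinearMap.ext hT'T)
  change T.inverse (mulInvariantVectorField (Ad g X) (g * h * g⁻¹)) = _
  rw [hinv, ← mfderiv_conj_mulInvariantVectorField]
  exact hT'T _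

/-- `Ad g` is a Lie algebra homomorphism. -/
theorem Ad_lie [CompleteSpace E] (g : G) (X Y : GroupLieAlgebra 𝓘(ℝ, E) G) :
    Ad (E := E) g ⁅X, Y⁆ = ⁅Ad (E := E) g X, Ad (E := E) g Y⁆ := by
  set Z := ⁅Ad (E := E) g X, Ad (E := E) g Y⁆ with hZ
  have h1 := VectorField.mpullback_mlieBracket (I := 𝓘(ℝ, E)) (I' := 𝓘(ℝ, E))
    (n := minSmoothness ℝ 3) (f := fun h : G => g * h * g⁻¹) (x₀ := 1)
    (V := mulInvariantVectorField (Ad (E := E) g X)) (W := mulInvariantVectorField (Ad (E := E) g Y))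
    (mdifferentiableAt_mulInvariantVectorField _) (mdifferentiableAt_mulInvariantVectorField _)
    (((contMDiff_mul_right (a := g⁻¹)).comp (contMDiff_mul_left (a := g))).contMDiffAt)
    (minSmoothness_monotone (by norm_cast))
  rw [mpullback_conj_mulInvariantVectorField, mpullback_conj_mulInvariantVectorField,
    ← mulInvariantVector_mlieBracket, ← GroupLieAlgebra.bracket_def, ← GroupLieAlgebra.bracket_def,
    ← hZ, ← Ad_apply_Ad_inv_apply g Z, mpullback_conj_mulInvariantVectorField,
    mulInvariantVectorField_one] at h1
  rw [← h1, Ad_apply_Ad_inv_apply]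

/-- `Ad g` as an automorphism of the Lie algebra. -/
noncomputable def AdEquiv [CompleteSpace E] (g : G) :
    GroupLieAlgebra 𝓘(ℝ, E) G ≃ₗ⁅ℝ⁆ GroupLieAlgebra 𝓘(ℝ, E) G where
  toFun := Ad g
  map_add' := map_add _
  map_smul' := map_smul _
  map_lie' := Ad_lie g _ _
  invFun := Ad g⁻¹
  left_inv := Ad_inv_apply_Ad_apply g
  right_inv := Ad_apply_Ad_inv_apply g

end Adjoint


/-! ### Maximal split abelian subalgebras -/

section SplitSubalgebras

open Module

variable {L : Type*} [LieRing L] [LieAlgebra ℝ L]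

/-- Every split element lies in a maximal abelian split subalgebra. -/
theorem exists_isMaximalSplitAbelian_of_isRSplit [Module.Finite ℝ L] {A : L} (hA : IsRSplit A) :
    ∃ 𝔞 : Submodule ℝ L, IsMaximalSplitAbelian 𝔞 ∧ A ∈ 𝔞 := by
  have h : IsSplitAbelian (ℝ ∙ A) := by
    refine ⟨fun X hX Y hY => ?_, fun X hX => ?_⟩
    · obtain ⟨s, rfl⟩ := Submodule.mem_span_singleton.1 hX
      obtain ⟨t, rfl⟩ := Submodule.mem_span_singleton.1 hY
      simp
    · obtain ⟨s, rfl⟩ := Submodule.mem_span_singleton.1 hX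
      exact hA.smul s
  obtain ⟨𝔞, hle, hmax⟩ := exists_maximal_ge_of_wellFoundedGT IsSplitAbelian _ h
  exact ⟨𝔞, hmax, hle (Submodule.mem_span_singleton_self A)⟩

/-- The positive root spaces of `A` lie in every subspace containing the eigenvectors of `ad A` with
positive eigenvalues. -/
theorem positiveRootSum_le {𝔞 W : Submodule ℝ L} {A : 𝔞}
    (hW : ∀ (c : ℝ) (U : L), 0 < c → ⁅(A : L), U⁆ = c • U → U ∈ W) : positiveRootSum 𝔞 A ≤ W :=
  iSup₂_le fun α hα U hU => hW (α A) U hα.2 (mem_rootSpace.1 hU A)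

end SplitSubalgebras

/-! ### Sequences in a Lie group with unbounded adjoint action -/

section LieGroups

open Filter Topology Module

variable {E : Type*} [NormedAddCommGroup E] [NormedSpace ℝ E]
  {G : Type*} [TopologicalSpace G] [ChartedSpace E G] [Group G]

/-- The vectors `U` which are asymptotically contracted by `Ad (g n)` along the filter `l`: they are
limits of vectors `u n` for which `Ad (g n) (u n)` tends to zero. -/
def contractedSubspace (l : Filter ℕ) (g : ℕ → G) :
    Submodule ℝ (GroupLieAlgebra 𝓘(ℝ, E) G) where
  carrier := {U | ∃ u : ℕ → GroupLieAlgebra 𝓘(ℝ, E) G,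
    Tendsto u l (𝓝 U) ∧ Tendsto (fun n => Ad (E := E) (g n) (u n)) l (𝓝 0)}
  zero_mem' := ⟨fun _ => 0, tendsto_const_nhds, by simpa using tendsto_const_nhds⟩
  add_mem' := by
    rintro U V ⟨u, hu, hu'⟩ ⟨v, hv, hv'⟩
    exact ⟨fun n => u n + v n, hu.add hv, by simpa using hu'.add hv'⟩
  smul_mem' := by
    rintro c U ⟨u, hu, hu'⟩
    exact ⟨fun n => c • u n, hu.const_smul c, by simpa using hu'.const_smul c⟩

theorem exists_isRSplit_forall_mem_contractedSubspace [FiniteDimensional ℝ E]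
    [LieGroup 𝓘(ℝ, E) ∞ G] [LieAlgebra.IsSemisimple ℝ (GroupLieAlgebra 𝓘(ℝ, E) G)] (g : ℕ → G)
    (hAd : Tendsto (fun n => Ad (E := E) (g n)) atTop
      (cocompact (GroupLieAlgebra 𝓘(ℝ, E) G →L[ℝ] GroupLieAlgebra 𝓘(ℝ, E) G))) :
    ∃ (A : GroupLieAlgebra 𝓘(ℝ, E) G) (l : Filter ℕ), A ≠ 0 ∧ IsRSplit A ∧ l.NeBot ∧
      ∀ (c : ℝ) (U : GroupLieAlgebra 𝓘(ℝ, E) G), 0 < c → ⁅A, U⁆ = c • U →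
        U ∈ contractedSubspace l g := by
  have : FiniteDimensional ℝ (GroupLieAlgebra 𝓘(ℝ, E) G) := inferInstanceAs (FiniteDimensional ℝ E)
  have : CompleteSpace E := FiniteDimensional.complete ℝ E
  let Φ₀ : E ≃L[ℝ] EuclideanSpace ℝ (Fin (finrank ℝ E)) := toEuclidean
  let Φ : GroupLieAlgebra 𝓘(ℝ, E) G ≃ₗ[ℝ] EuclideanSpace ℝ (Fin (finrank ℝ E)) :=
    Φ₀.toLinearEquiv
  have hψ := tendsto_norm_cocompact_atTop.comp
    (((Φ₀.arrowCongr Φ₀).toHomeomorph.isClosedEmbedding.tendsto_cocompact).comp hAd)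
  obtain ⟨A, l, hA0, hA, hl, h⟩ :=
    exists_isRSplit_asymptotically_contracted Φ (fun n => AdEquiv (E := E) (g n)) hψ
  have hΦ : ∀ {w : ℕ → E} {a : E}, Tendsto (fun n => Φ₀ (w n)) l (𝓝 (Φ₀ a)) →
      Tendsto w l (𝓝 a) := fun h => Φ₀.toHomeomorph.isInducing.tendsto_nhds_iff.2 h
  refine ⟨A, l, hA0, hA, hl, fun c U hc hU => ?_⟩
  obtain ⟨u, hu, hu'⟩ := h c U hc hU
  have h0 : (0 : EuclideanSpace ℝ (Fin (finrank ℝ E))) = Φ₀ 0 := (map_zero Φ₀).symm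
  exact ⟨u, hΦ hu, hΦ (a := 0) (hu'.mono_right (congrArg 𝓝 h0).le)⟩

end LieGroups

/-! ### Isometric actions -/

section Actions

open Filter Topology

variable {F : Type*} [NormedAddCommGroup F] [NormedSpace ℝ F]
  {M : Type*} [TopologicalSpace M] [ChartedSpace F M]

/-- The isotropy action of a stabilizer element preserves the inner product of the tangent space. -/
theorem form_mfderiv_smul_of_smul_eq {G : Type*} [Group G] [MulAction G M]
    [IsManifold 𝓘(ℝ, F) ∞ M] {q : LorentzMetric F M}
    (hq : IsIsometricAction G q) {g : G} {y : M} (hg : g • y = y) (v w : F) :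
    (q.form y : F →L[ℝ] F →L[ℝ] ℝ)
      ((mfderiv 𝓘(ℝ, F) 𝓘(ℝ, F) (fun z : M => g • z) y : F →L[ℝ] F) v)
      ((mfderiv 𝓘(ℝ, F) 𝓘(ℝ, F) (fun z : M => g • z) y : F →L[ℝ] F) w) =
      (q.form y : F →L[ℝ] F →L[ℝ] ℝ) v w := by
  have h := hq g y v w
  let Q : M → F →L[ℝ] F →L[ℝ] ℝ := fun z => q.form z
  let T : F →L[ℝ] F := mfderiv 𝓘(ℝ, F) 𝓘(ℝ, F) (fun z : M => g • z) y
  have hQ : Q y (T v) (T w) = Q (g • y) (T v) (T w) := by rw [hg]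
  exact hQ.trans h


variable {E : Type*} [NormedAddCommGroup E] [NormedSpace ℝ E]
  {G : Type*} [TopologicalSpace G] [ChartedSpace E G] [Group G] [MulAction G M]

/-- The derivative of the orbit map intertwines `Ad g` with the isotropy action of a stabilizer
element `g`. -/
theorem orbitDeriv_Ad [LieGroup 𝓘(ℝ, E) ∞ G] [ContMDiffSMul 𝓘(ℝ, E) 𝓘(ℝ, F) ∞ G M] {g : G} {y : M}
    (hg : g • y = y) (X : GroupLieAlgebra 𝓘(ℝ, E) G) :
    (orbitDeriv y (Ad (E := E) g X) : F) =
      (mfderiv 𝓘(ℝ, F) 𝓘(ℝ, F) (fun z : M => g • z) y : F →L[ℝ] F) (orbitDeriv y X) := by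
  have horb : MDifferentiable 𝓘(ℝ, E) 𝓘(ℝ, F) fun h : G => h • y :=
    (contMDiff_id.smul contMDiff_const : ContMDiff 𝓘(ℝ, E) 𝓘(ℝ, F) ∞ _).mdifferentiable (by simp)
  have hact : MDifferentiable 𝓘(ℝ, F) 𝓘(ℝ, F) fun z : M => g • z :=
    (ContMDiff.smul (I := 𝓘(ℝ, E)) (n := ∞) contMDiff_const contMDiff_id).mdifferentiable
      (by simp)
  have h1 := mfderiv_comp_apply_of_eq (f := fun h : G => g * h * g⁻¹) (k := fun h : G => h • y)
    (x := 1) (z := 1) (by simp) horb.mdifferentiableAt (mdifferentiable_conj g).mdifferentiableAt X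
  have h2 := mfderiv_comp_apply_of_eq (f := fun h : G => h • y) (k := fun z : M => g • z)
    (x := 1) (z := y) (one_smul G y) hact.mdifferentiableAt horb.mdifferentiableAt X
  have h3 : (fun h : G => (g * h * g⁻¹) • y) = fun h => g • h • y := by
    ext h
    rw [mul_smul, mul_smul, inv_smul_eq_iff.2 hg.symm]
  rw [h3] at h1
  exact h1.symm.trans h2

variable [LieGroup 𝓘(ℝ, E) ∞ G] [IsManifold 𝓘(ℝ, F) ∞ M] [ContMDiffSMul 𝓘(ℝ, E) 𝓘(ℝ, F) ∞ G M]
  {q : LorentzMetric F M} {l : Filter ℕ} [l.NeBot] {y : M} {g : ℕ → G}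

/-- A contracted vector `U` is orthogonal to every limit `V` of tangent vectors `v n` whose images
under the isotropy action of `g n` converge: if `u n → U` with `Ad (g n) (u n) → 0`, then
`⟨f_y (u n), v n⟩`, which tends to `⟨f_y U, V⟩`, is by invariance a pairing of vectors tending to `0`
with convergent ones. -/
theorem form_orbitDeriv_eq_zero_of_tendsto (hq : IsIsometricAction G q) (hg : ∀ n, g n • y = y)
    {U : GroupLieAlgebra 𝓘(ℝ, E) G} (hU : U ∈ contractedSubspace l g) {v v' : ℕ → F} {V V' : F}
    (hv : Tendsto v l (𝓝 V)) (hv' : Tendsto v' l (𝓝 V'))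
    (h : ∀ n, (mfderiv 𝓘(ℝ, F) 𝓘(ℝ, F) (fun z : M => g n • z) y : F →L[ℝ] F) (v n) = v' n) :
    (q.form y : F →L[ℝ] F →L[ℝ] ℝ) (orbitDeriv y U) V = 0 := by
  obtain ⟨u, hu, hu'⟩ := hU
  let B : F →L[ℝ] F →L[ℝ] ℝ := q.form y
  let f : E →L[ℝ] F := orbitDeriv (G := G) y
  have hlim : ∀ {a : ℕ → E} {b : ℕ → F} {a₀ : E} {b₀ : F}, Tendsto a l (𝓝 a₀) →
      Tendsto b l (𝓝 b₀) → Tendsto (fun n => B (f (a n)) (b n)) l (𝓝 (B (f a₀) b₀)) := by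
    intro a b a₀ b₀ ha hb
    exact (B.continuous₂.tendsto (f a₀, b₀)).comp
      (((f.continuous.tendsto a₀).comp ha).prodMk_nhds hb)
  have h1 : Tendsto (fun n => B (f (u n)) (v n)) l (𝓝 (B (f U) V)) := hlim hu hv
  have h2 : Tendsto (fun n => B (f (Ad (E := E) (g n) (u n))) (v' n)) l (𝓝 (B (f 0) V')) :=
    hlim hu' hv'
  have h3 : ∀ n, B (f (Ad (E := E) (g n) (u n))) (v' n) = B (f (u n)) (v n) := by
    intro n
    rw [← h n]
    have h4 : f (Ad (E := E) (g n) (u n)) =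
        (mfderiv 𝓘(ℝ, F) 𝓘(ℝ, F) (fun z : M => g n • z) y : F →L[ℝ] F) (f (u n)) :=
      orbitDeriv_Ad (hg n) (u n)
    rw [h4]
    exact form_mfderiv_smul_of_smul_eq hq (hg n) (f (u n)) (v n)
  simp only [h3, map_zero, zero_apply] at h2
  exact tendsto_nhds_unique h1 h2

theorem pulledBackForm_eq_zero_of_mem_contractedSubspace (hq : IsIsometricAction G q)
    (hg : ∀ n, g n • y = y) {U V : GroupLieAlgebra 𝓘(ℝ, E) G} (hU : U ∈ contractedSubspace l g)
    (hV : V ∈ contractedSubspace l g) : pulledBackForm q y U V = 0 := by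
  obtain ⟨v, hv, hv'⟩ := hV
  let f : E →L[ℝ] F := orbitDeriv (G := G) y
  exact form_orbitDeriv_eq_zero_of_tendsto hq hg hU (v := fun n => f (v n))
    (v' := fun n => f (Ad (E := E) (g n) (v n))) ((f.continuous.tendsto _).comp hv)
    ((f.continuous.tendsto _).comp hv') fun n => (orbitDeriv_Ad (hg n) (v n)).symm

/-- A vector field along the orbit that is preserved by the group is, at the base point, fixed by
the isotropy action, and therefore orthogonal to the contracted directions. -/
theorem pulledBackForm_eq_zero_of_isInvariantAlongOrbit (hq : IsIsometricAction G q)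
    (hg : ∀ n, g n • y = y) {U S : GroupLieAlgebra 𝓘(ℝ, E) G} (hU : U ∈ contractedSubspace l g)
    {Sstar : (x : M) → TangentSpace 𝓘(ℝ, F) x} (hinv : IsInvariantAlongOrbit G y Sstar)
    (hS : orbitDeriv y S = Sstar y) : pulledBackForm q y U S = 0 := by
  have h := form_orbitDeriv_eq_zero_of_tendsto hq hg hU (v := fun _ => Sstar y)
    (v' := fun _ => Sstar y) tendsto_const_nhds tendsto_const_nhds fun n =>
      (hinv (g n) y (MulAction.mem_orbit_self y)).trans
        (congrArg (fun x : M => (Sstar x : F)) (hg n))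
  rw [← hS] at h
  exact h

end Actions

end KowalskyLorentz

theorem mainTheorem7
    {E : Type*} [NormedAddCommGroup E] [NormedSpace ℝ E] [FiniteDimensional ℝ E]
    {G : Type*} [TopologicalSpace G] [ChartedSpace E G] [Group G]
    [LieGroup 𝓘(ℝ, E) ∞ G] [ConnectedSpace G]
    [LieAlgebra.IsSemisimple ℝ (GroupLieAlgebra 𝓘(ℝ, E) G)]
    {F : Type*} [NormedAddCommGroup F] [NormedSpace ℝ F] [FiniteDimensional ℝ F]
    {M : Type*} [TopologicalSpace M] [T2Space M] [SecondCountableTopology M]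
    [ChartedSpace F M] [IsManifold 𝓘(ℝ, F) ∞ M]
    [MulAction G M] [ContMDiffSMul 𝓘(ℝ, E) 𝓘(ℝ, F) ∞ G M]
    (q : KowalskyLorentz.LorentzMetric F M)
    (hq : KowalskyLorentz.IsIsometricAction G q)
    (y : M) (g : ℕ → G) (hg : ∀ n, g n ∈ MulAction.stabilizer G y)
    (hAd : Filter.Tendsto (fun n => KowalskyLorentz.Ad (E := E) (g n)) Filter.atTop
      (Filter.cocompact (GroupLieAlgebra 𝓘(ℝ, E) G →L[ℝ] GroupLieAlgebra 𝓘(ℝ, E) G))) :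
    ∃ (𝔞 : Submodule ℝ (GroupLieAlgebra 𝓘(ℝ, E) G)) (A : 𝔞),
      KowalskyLorentz.IsMaximalSplitAbelian 𝔞 ∧ A ≠ 0 ∧
      (∀ U ∈ KowalskyLorentz.positiveRootSum 𝔞 A, ∀ V ∈ KowalskyLorentz.positiveRootSum 𝔞 A,
        KowalskyLorentz.pulledBackForm q y U V = 0) ∧
      (∀ (Sstar : (x : M) → TangentSpace 𝓘(ℝ, F) x),
        KowalskyLorentz.IsIsotropicAlongOrbit G q y Sstar →
        KowalskyLorentz.IsInvariantAlongOrbit G y Sstar →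
        ∀ S : GroupLieAlgebra 𝓘(ℝ, E) G, KowalskyLorentz.orbitDeriv y S = Sstar y →
        ∀ U ∈ KowalskyLorentz.positiveRootSum 𝔞 A,
          KowalskyLorentz.pulledBackForm q y U S = 0) := by
  obtain ⟨A, l, hA0, hA, hl, hmem⟩ :=
    KowalskyLorentz.exists_isRSplit_forall_mem_contractedSubspace g hAd
  have : FiniteDimensional ℝ (GroupLieAlgebra 𝓘(ℝ, E) G) := inferInstanceAs (FiniteDimensional ℝ E)
  obtain ⟨𝔞, h𝔞, hA𝔞⟩ := KowalskyLorentz.exists_isMaximalSplitAbelian_of_isRSplit hA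
  have hle := KowalskyLorentz.positiveRootSum_le (A := (⟨A, hA𝔞⟩ : 𝔞)) hmem
  refine ⟨𝔞, ⟨A, hA𝔞⟩, h𝔞, fun h => hA0 (congrArg Subtype.val h), fun U hU V hV => ?_,
    fun Sstar _ hinv S hS U hU => ?_⟩
  · exact KowalskyLorentz.pulledBackForm_eq_zero_of_mem_contractedSubspace hq hg (hle hU) (hle hV)
  · exact KowalskyLorentz.pulledBackForm_eq_zero_of_isInvariantAlongOrbit hq hg (hle hU) hinv hS
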